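/- Let $\Sigma_2$ be an alphabet with exactly two letters and let $k \in \mathbb{N}_0$. Two words $u, v \in \Sigma_2^*$ are called Simon $k$-congruent, written $u \sim_k v$, if they have the same scattered factors (that is, not necessarily contiguous subsequences) of length at most $k$. Define integers $c_k^m$ for integers $k$ and $m \ge -1$ by \[ c_k^{-1} := 1, \qquad c_k^0 := 2k+1, \qquad c_k^m := 2(k-m+1)\, c_{k-1}^{m-1} - 2(k-m)\, c_{k-2}^{m-2} \quad (m \ge 1). \] Then the number of congruence classes of $\sim_k$ on $\Sigma_2^*$ is finite and given by \[ |\Sigma_2^*/{\sim_k}| = 1 + \sum_{m=0}^{k-1} c_k^m . \] -/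

import Mathlib

/-- The scattered factors (subsequences) of the word `w` of length at most `k`. -/
def scatFactLE {A : Type*} (k : ℕ) (w : List A) : Set (List A) :=
  {v | v.Sublist w ∧ v.length ≤ k}

/-- Simon's congruence of level `k` on the words over `A`: two words are related iff they have
the same scattered factors of length at most `k`. -/
def simonCongruence (A : Type*) (k : ℕ) : Setoid (List A) where
  r u v := scatFactLE k u = scatFactLE k v
  iseqv := ⟨fun _ => rfl, fun h => h.symm, fun h h' => h.trans h'⟩

theorem simonCongruence_append {A : Type*} {k : ℕ} {u u' v v' : List A}
    (hu : simonCongruence A k u u') (hv : simonCongruence A k v v') :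
    simonCongruence A k (u ++ v) (u' ++ v') := by
  have key : ∀ {u u' v v' : List A}, scatFactLE k u = scatFactLE k u' →
      scatFactLE k v = scatFactLE k v' → scatFactLE k (u ++ v) ⊆ scatFactLE k (u' ++ v') := by
    rintro u u' v v' hu hv w ⟨hw, hl⟩
    obtain ⟨w₁, w₂, rfl, h₁, h₂⟩ := List.sublist_append_iff.1 hw
    rw [List.length_append] at hl
    have h₁' : w₁ ∈ scatFactLE k u' := hu ▸ ⟨h₁, by omega⟩
    have h₂' : w₂ ∈ scatFactLE k v' := hv ▸ ⟨h₂, by omega⟩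
    exact ⟨h₁'.1.append h₂'.1, by rw [List.length_append]; exact hl⟩
  exact Set.Subset.antisymm (key hu hv) (key hu.symm hv.symm)

/-- The numbers `c_k^m` with the upper index shifted by one: `simonCoeffAux n k` is `c_k^(n-1)`. -/
def simonCoeffAux : ℕ → ℤ → ℤ
  | 0, _ => 1
  | 1, k => 2 * k + 1
  | n + 2, k =>
      2 * (k - (n + 1) + 1) * simonCoeffAux (n + 1) (k - 1)
        - 2 * (k - (n + 1)) * simonCoeffAux n (k - 2)

/-- The numbers `c_k^m` for `m ≥ -1`, given by `c_k^(-1) = 1`, `c_k^0 = 2 k + 1` and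
`c_k^m = 2 (k - m + 1) c_(k-1)^(m-1) - 2 (k - m) c_(k-2)^(m-2)` for `m ≥ 1`; the three
equations are the lemmas below. -/
def simonCoeff (k m : ℤ) : ℤ := simonCoeffAux (m + 1).toNat k

theorem simonCoeff_neg_one (k : ℤ) : simonCoeff k (-1) = 1 := by
  simp [simonCoeff, simonCoeffAux]

theorem simonCoeff_zero (k : ℤ) : simonCoeff k 0 = 2 * k + 1 := by
  simp [simonCoeff, simonCoeffAux]

theorem simonCoeff_of_one_le (k m : ℤ) (hm : 1 ≤ m) :
    simonCoeff k m = 2 * (k - m + 1) * simonCoeff (k - 1) (m - 1)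
      - 2 * (k - m) * simonCoeff (k - 2) (m - 2) := by
  obtain ⟨n, rfl⟩ : ∃ n : ℕ, m = n + 1 := ⟨(m - 1).toNat, by omega⟩
  have h₁ : ((n : ℤ) + 1 + 1).toNat = n + 2 := by omega
  have h₂ : ((n : ℤ) + 1 - 1 + 1).toNat = n + 1 := by omega
  have h₃ : ((n : ℤ) + 1 - 2 + 1).toNat = n := by omega
  rw [simonCoeff, simonCoeff, simonCoeff, h₁, h₂, h₃, simonCoeffAux]

/-!
Over two letters, cut a word `w` greedily from the left into arches `c ^ (i + 1) * c̄`, leaving a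
rest that uses at most one letter. If there are `n` arches, then `w` is `n`-universal but not
`(n + 1)`-universal, so for `n < k` the class of `w` determines `n`, while all words with at least
`k` arches form one class.

Cutting `w` greedily from the right instead gives `n` arches whose overlaps with the left ones,
together with the two ends, are `n + 1` powers of letters (the factors `α` of the
`α`-`β`-factorization). Two words with `n < k` arches are congruent iff they have the same cores
between these powers and each power agrees with its counterpart after capping its exponent at
`K := k - n`: a word of length `n` that fits tightly into the context of a power leaves exactly
`K` letters for testing that power, and universality of the context absorbs any further letter.

Let `N n` be the number of normal forms with `n` arches and all powers capped at `K`. Prepending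
one of the `2 * (K + 1)` arches `c ^ (i + 1) * c̄` with `i ≤ K` to one of these yields a normal form
unless `i = K` and its leading power is a nonempty power of `c`. The number of normal forms with `n`
arches and nonempty leading power is `2 * K * N (n - 1)`, since exactly `K` of the admissible
exponents produce one for each letter and each normal form with `n - 1` arches. Hence
`N (n + 1) = 2 * (K + 1) * N n - 2 * K * N (n - 1)`.
-/

namespace Simon

open List

theorem simonCoeff_add_succ (K : ℤ) (n : ℕ) :
    simonCoeff (n + 1 + K) (n + 1) =
      2 * (K + 1) * simonCoeff (n + K) n - 2 * K * simonCoeff (n - 1 + K) (n - 1) := by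
  rw [simonCoeff_of_one_le _ _ (by omega)]
  ring_nf

section AnyAlphabet

variable {A : Type*}

theorem simonCongruence_iff {k : ℕ} {u v : List A} :
    simonCongruence A k u v ↔ ∀ t : List A, t.length ≤ k → (t <+ u ↔ t <+ v) :=
  Set.ext_iff.trans (forall_congr' fun _ => and_congr_left_iff)

theorem eq_of_simonCongruence {k : ℕ} {u v : List A} (h : simonCongruence A k u v)
    (hu : u.length ≤ k) (hv : v.length ≤ k) : u = v :=
  ((simonCongruence_iff.1 h u hu).1 (.refl u)).antisymm ((simonCongruence_iff.1 h v hv).2 (.refl v))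

theorem scatFactLE_map {B : Type*} (e : A ≃ B) (k : ℕ) (w : List A) :
    scatFactLE k (w.map e) = List.map e '' scatFactLE k w := by
  ext t
  constructor
  · rintro ⟨ht, htk⟩
    obtain ⟨s, hs, rfl⟩ := sublist_map_iff.1 ht
    exact ⟨s, ⟨hs, by simpa using htk⟩, rfl⟩
  · rintro ⟨s, ⟨hs, hsk⟩, rfl⟩
    exact ⟨hs.map e, by simpa using hsk⟩

/-- The bijection between the congruence classes over two alphabets that is induced by a bijection
of the alphabets. -/
def quotientCongr {B : Type*} (e : A ≃ B) (k : ℕ) :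
    Quotient (simonCongruence A k) ≃ Quotient (simonCongruence B k) :=
  Quotient.congr (Equiv.listEquivOfEquiv e) fun u v => by
    change scatFactLE k u = scatFactLE k v ↔ scatFactLE k (u.map e) = scatFactLE k (v.map e)
    rw [scatFactLE_map, scatFactLE_map, (map_injective_iff.2 e.injective).image_injective.eq_iff]

/-- A word is `n`-universal if every word of length at most `n` is a scattered factor of it. -/
def IsUniversal (n : ℕ) (x : List A) : Prop := ∀ t : List A, t.length ≤ n → t <+ x

theorem isUniversal_zero (x : List A) : IsUniversal 0 x := fun t ht => by
  simp [length_eq_zero_iff.1 (Nat.le_zero.1 ht)]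

theorem IsUniversal.mono {m n : ℕ} {x : List A} (h : IsUniversal n x) (hmn : m ≤ n) :
    IsUniversal m x := fun t ht => h t (ht.trans hmn)

theorem IsUniversal.append_left {n : ℕ} {x : List A} (h : IsUniversal n x) (y : List A) :
    IsUniversal n (y ++ x) := fun t ht => (h t ht).trans (sublist_append_right y x)

theorem IsUniversal.append_of_forall_mem {n : ℕ} {x v : List A} (h : IsUniversal n x)
    (hv : ∀ c, c ∈ v) : IsUniversal (n + 1) (x ++ v) := by
  intro t ht
  rcases t.eq_nil_or_concat' with rfl | ⟨s, c, rfl⟩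
  · exact nil_sublist _
  · exact (h s (by simpa using ht)).append (singleton_sublist.2 (hv c))

theorem IsUniversal.append_left_of_forall_mem {n : ℕ} {x v : List A} (h : IsUniversal n x)
    (hv : ∀ c, c ∈ v) : IsUniversal (n + 1) (v ++ x) := by
  rintro (_ | ⟨c, t⟩) ht
  · exact nil_sublist _
  · exact (singleton_sublist.2 (hv c)).append (h t (by simpa using ht))

theorem exists_isUniversal [Finite A] (n : ℕ) : ∃ x : List A, IsUniversal n x := by
  obtain ⟨v, -, hv⟩ := Finite.exists_univ_list A
  induction n with
  | zero => exact ⟨[], isUniversal_zero _⟩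
  | succ n ih =>
    obtain ⟨x, hx⟩ := ih
    exact ⟨x ++ v, hx.append_of_forall_mem hv⟩

theorem IsUniversal.of_simonCongruence {n k : ℕ} {x y : List A} (hx : IsUniversal n x) (hn : n ≤ k)
    (h : simonCongruence A k x y) : IsUniversal n y := fun t ht =>
  (simonCongruence_iff.1 h t (ht.trans hn)).1 (hx t ht)

theorem IsUniversal.simonCongruence {k : ℕ} {x y : List A} (hx : IsUniversal k x)
    (hy : IsUniversal k y) : simonCongruence A k x y :=
  simonCongruence_iff.2 fun t ht => iff_of_true (hx t ht) (hy t ht)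

theorem sublist_of_cons_sublist_append_cons {e : A} {v t z : List A} (he : e ∉ v)
    (h : e :: t <+ v ++ e :: z) : t <+ z := by
  induction v with
  | nil => exact h.of_cons_cons
  | cons a v ih =>
    rw [mem_cons, not_or] at he
    rw [cons_append, cons_sublist_cons'] at h
    exact ih he.2 (h.resolve_right fun h' => he.1 h'.1)

theorem sublist_of_concat_sublist_append_cons {e : A} {v t z : List A} (he : e ∉ v)
    (h : t ++ [e] <+ z ++ e :: v) : t <+ z :=
  reverse_sublist.1 <| sublist_of_cons_sublist_append_cons (by simpa using he : e ∉ v.reverse)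
    (by simpa using h.reverse)

/-- `x` is `n`-universal, and some word of length `n` occurs in `x` but in no shorter prefix, so
that it leaves no letter of `x` for what follows it. -/
def LeftTight (n : ℕ) (x : List A) : Prop :=
  IsUniversal n x ∧ ∃ p : List A, p.length = n ∧ ∀ t z, p ++ t <+ x ++ z → t <+ z

/-- `y` is `n`-universal, and some word of length `n` occurs in `y` but in no shorter suffix, so
that it leaves no letter of `y` for what precedes it. -/
def RightTight (n : ℕ) (y : List A) : Prop :=
  IsUniversal n y ∧ ∃ q : List A, q.length = n ∧ ∀ t z, t ++ q <+ z ++ y → t <+ z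

theorem leftTight_nil : LeftTight 0 ([] : List A) :=
  ⟨isUniversal_zero _, [], rfl, fun _ _ h => h⟩

theorem rightTight_nil : RightTight 0 ([] : List A) :=
  ⟨isUniversal_zero _, [], rfl, fun _ _ h => by simpa using h⟩

theorem LeftTight.append_concat {n : ℕ} {x v : List A} {e : A} (hx : LeftTight n x) (he : e ∉ v)
    (hv : ∀ c, c ∈ v ++ [e]) : LeftTight (n + 1) (x ++ (v ++ [e])) := by
  obtain ⟨hu, p, hp, h⟩ := hx
  refine ⟨hu.append_of_forall_mem hv, p ++ [e], by simp [hp], fun t z htz => ?_⟩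
  exact sublist_of_cons_sublist_append_cons he (h _ _ (by simpa using htz))

theorem RightTight.cons_append {n : ℕ} {y v : List A} {e : A} (hy : RightTight n y) (he : e ∉ v)
    (hv : ∀ c, c ∈ e :: v) : RightTight (n + 1) (e :: (v ++ y)) := by
  obtain ⟨hu, q, hq, h⟩ := hy
  refine ⟨hu.append_left_of_forall_mem hv, e :: q, by simp [hq], fun t z htz => ?_⟩
  exact sublist_of_concat_sublist_append_cons he (h (t ++ [e]) (z ++ e :: v) (by simpa using htz))

theorem RightTight.not_isUniversal_append {n : ℕ} {y z : List A} {c : A} (hy : RightTight n y)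
    (hc : c ∉ z) : ¬ IsUniversal (n + 1) (z ++ y) := by
  obtain ⟨-, q, hq, h⟩ := hy
  exact fun hu => hc (singleton_sublist.1 (h [c] z (hu _ (by simp [hq]))))

theorem sublist_of_sandwich {i n j k : ℕ} {x x' y y' z z' t : List A} (hx : LeftTight i x)
    (hx' : IsUniversal i x') (hy : RightTight n y) (hy' : IsUniversal n y') (hk : i + n + j ≤ k)
    (h : simonCongruence A k (x ++ (z ++ y)) (x' ++ (z' ++ y'))) (htj : t.length ≤ j)
    (ht : t <+ z') : t <+ z := by
  obtain ⟨-, p, hp, hp'⟩ := hx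
  obtain ⟨-, q, hq, hq'⟩ := hy
  have hlen : (p ++ (t ++ q)).length ≤ k := by simp only [length_append]; omega
  exact hq' _ _ (hp' _ _ ((simonCongruence_iff.1 h _ hlen).2
    ((hx' p hp.le).append (ht.append (hy' q hq.le)))))

theorem simonCongruence_of_sandwich {i n j k : ℕ} {x x' y y' z z' : List A} (hx : LeftTight i x)
    (hx' : LeftTight i x') (hy : RightTight n y) (hy' : RightTight n y') (hk : i + n + j ≤ k)
    (h : simonCongruence A k (x ++ (z ++ y)) (x' ++ (z' ++ y'))) : simonCongruence A j z z' :=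
  simonCongruence_iff.2 fun _ ht =>
    ⟨sublist_of_sandwich hx' hx.1 hy' hy.1 hk (Setoid.symm' _ h) ht,
      sublist_of_sandwich hx hx'.1 hy hy'.1 hk h ht⟩

theorem simonCongruence_replicate_succ {i j n k : ℕ} {x y : List A} (hx : IsUniversal i x)
    (hy : IsUniversal n y) (hk : k ≤ i + j + n) (a : A) :
    simonCongruence A k (x ++ (replicate j a ++ y)) (x ++ (replicate (j + 1) a ++ y)) := by
  refine simonCongruence_iff.2 fun t htk => ⟨fun ht => ht.trans ?_, fun ht => ?_⟩
  · exact .append (.refl x) (.append ((replicate_sublist_replicate a).2 j.le_succ) (.refl y))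
  · obtain ⟨t₁, s, rfl, ht₁, hs⟩ := sublist_append_iff.1 ht
    obtain ⟨t₂, t₃, rfl, ht₂, ht₃⟩ := sublist_append_iff.1 hs
    obtain ⟨m, hm, rfl⟩ := sublist_replicate_iff.1 ht₂
    simp only [length_append, length_replicate] at htk
    rcases hm.lt_or_eq with hmj | rfl
    · exact ht₁.append (.append ((replicate_sublist_replicate a).2 (Nat.lt_succ_iff.1 hmj)) ht₃)
    -- One letter `a` is too many for `a ^ j`; the context that is not yet exhausted absorbs it.
    · by_cases h₁ : t₁.length < i
      · have : t₁ ++ [a] <+ x := hx _ (by simpa using h₁)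
        simpa [replicate_succ] using this.append (Sublist.append (.refl _) ht₃)
      · have : a :: t₃ <+ y := hy _ (by rw [length_cons]; omega)
        simpa [replicate_succ'] using ht₁.append (Sublist.append (.refl _) this)

theorem simonCongruence_replicate_min {i n K k : ℕ} {x y : List A} (hx : IsUniversal i x)
    (hy : IsUniversal n y) (hk : k ≤ i + K + n) (a : A) (j : ℕ) :
    simonCongruence A k (x ++ (replicate j a ++ y)) (x ++ (replicate (min j K) a ++ y)) := by
  rcases le_total j K with hj | hj
  · rw [min_eq_left hj]
  · rw [min_eq_right hj]
    induction j, hj using Nat.le_induction with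
    | base => exact Setoid.refl' _ _
    | succ j hj ih =>
      exact Setoid.trans' _
        (Setoid.symm' _ (simonCongruence_replicate_succ hx hy (by omega) a)) ih

end AnyAlphabet

theorem eq_replicate_or_eq_arch_append (w : List Bool) :
    (∃ j c, w = replicate j c) ∨ ∃ i c v, w = replicate (i + 1) c ++ (!c) :: v := by
  induction w with
  | nil => exact .inl ⟨0, true, rfl⟩
  | cons d w ih =>
    rcases ih with ⟨j, c, rfl⟩ | ⟨i, c, v, rfl⟩ <;> obtain rfl | rfl := Bool.eq_or_eq_not c d
    · exact .inl ⟨j + 1, c, rfl⟩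
    · cases j with
      | zero => exact .inl ⟨1, d, rfl⟩
      | succ j => exact .inr ⟨0, d, replicate j !d, rfl⟩
    · exact .inr ⟨i + 1, c, v, rfl⟩
    · exact .inr ⟨0, d, replicate i (!d) ++ (!!d) :: v, rfl⟩

theorem mem_replicate_succ_append_not (c : Bool) (i : ℕ) (b : Bool) :
    b ∈ replicate (i + 1) c ++ [!c] := by
  cases b <;> cases c <;> simp

theorem LeftTight.append_arch {m : ℕ} {u : List Bool} (hu : LeftTight m u) (c : Bool) (i : ℕ) :
    LeftTight (m + 1) (u ++ (replicate (i + 1) c ++ [!c])) :=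
  hu.append_concat (by simp) (mem_replicate_succ_append_not c i)

/-- Binary words cut greedily from the left into `n` arches and a rest. Every binary word has
exactly one such factorization: `rest none` is the empty word, `rest (some (c, j))` is
`c ^ (j + 1)`, and `arch c i x` puts the arch `c ^ (i + 1) * c̄` in front of `x`. -/
inductive ArchFactorization : ℕ → Type
  | rest (s : Option (Bool × ℕ)) : ArchFactorization 0
  | arch {n : ℕ} (c : Bool) (i : ℕ) (x : ArchFactorization n) : ArchFactorization (n + 1)

namespace ArchFactorization

/-- The leading power: the part of the word in front of its `n` arches counted from the right. An
arch `c ^ (i + 1) * c̄` from the left loses its last `c` to the arch `c * c̄ ^ (j + 1)` from the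
right, unless the latter starts at `c̄` because another `c` follows. -/
def lead {n : ℕ} : ArchFactorization n → List Bool
  | rest s => s.elim [] fun p => replicate (p.2 + 1) p.1
  | arch c i x => replicate (if c ∈ x.lead then i + 1 else i) c

/-- The word denoted by an arch factorization. -/
def word {n : ℕ} : ArchFactorization n → List Bool
  | x@(rest _) => x.lead
  | arch c i x => replicate (i + 1) c ++ (!c) :: x.word

/-- The part of the word behind its leading power, that is, its `n` arches counted from the
right. -/
def tail {n : ℕ} : ArchFactorization n → List Bool
  | rest _ => []
  | arch c _ x => if c ∈ x.lead then (!c) :: x.word else c :: (!c) :: x.word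

theorem lead_append_tail {n : ℕ} (x : ArchFactorization n) : x.lead ++ x.tail = x.word := by
  cases x with
  | rest s => simp [tail, word]
  | arch c i x => by_cases hc : c ∈ x.lead <;> simp [lead, tail, word, hc, replicate_succ']

theorem exists_lead_eq_replicate {n : ℕ} (x : ArchFactorization n) :
    ∃ j c, x.lead = replicate j c := by
  rcases x with (_ | ⟨c, j⟩) | ⟨c, i, x⟩
  · exact ⟨0, true, rfl⟩
  all_goals exact ⟨_, c, rfl⟩

theorem exists_notMem_lead {n : ℕ} (x : ArchFactorization n) : ∃ c, c ∉ x.lead := by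
  obtain ⟨j, c, hx⟩ := x.exists_lead_eq_replicate
  exact ⟨!c, by simp [hx]⟩

theorem rightTight_tail {n : ℕ} (x : ArchFactorization n) : RightTight n x.tail := by
  induction x with
  | rest _ => exact rightTight_nil
  | arch c i x ih =>
    rw [tail, ← x.lead_append_tail]
    obtain ⟨d, hd⟩ := x.exists_notMem_lead
    split_ifs with hc
    · obtain rfl : d = !c := Bool.eq_not_of_ne fun h => hd (h ▸ hc)
      exact ih.cons_append hd fun b => by cases b <;> cases c <;> simp [hc]
    · exact ih.cons_append (v := (!c) :: x.lead) (by simp [hc]) fun b => by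
        cases b <;> cases c <;> simp

theorem isUniversal_word {n : ℕ} (x : ArchFactorization n) : IsUniversal n x.word :=
  x.lead_append_tail ▸ x.rightTight_tail.1.append_left x.lead

theorem not_isUniversal_word {n m : ℕ} (x : ArchFactorization n) (hm : n < m) :
    ¬ IsUniversal m x.word := by
  obtain ⟨c, hc⟩ := x.exists_notMem_lead
  rw [← x.lead_append_tail]
  exact fun h => x.rightTight_tail.not_isUniversal_append hc (h.mono hm)

theorem arches_le_of_simonCongruence {n m k : ℕ} {x : ArchFactorization n}
    {y : ArchFactorization m} (hn : n < k) (h : simonCongruence Bool k x.word y.word) : m ≤ n := by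
  by_contra! hlt
  exact x.not_isUniversal_word n.lt_succ_self
    ((y.isUniversal_word.mono hlt).of_simonCongruence hn (Setoid.symm' _ h))

theorem arches_eq_of_simonCongruence {n m k : ℕ} {x : ArchFactorization n}
    {y : ArchFactorization m} (hn : n < k) (hm : m < k)
    (h : simonCongruence Bool k x.word y.word) : n = m :=
  (arches_le_of_simonCongruence hm (Setoid.symm' _ h)).antisymm (arches_le_of_simonCongruence hn h)

theorem exists_word_eq (w : List Bool) : ∃ (n : ℕ) (x : ArchFactorization n), x.word = w := by
  induction hl : w.length using Nat.strong_induction_on generalizing w with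
  | _ l ih =>
    rcases eq_replicate_or_eq_arch_append w with ⟨_ | j, c, rfl⟩ | ⟨i, c, v, rfl⟩
    · exact ⟨0, rest none, rfl⟩
    · exact ⟨0, rest (some (c, j)), rfl⟩
    · obtain ⟨n, x, rfl⟩ := ih v.length (by simp at hl; omega) v rfl
      exact ⟨n + 1, arch c i x, rfl⟩

/-- The factorizations with `n` arches of the words all of whose powers have length at most `K`. -/
def normalForms (K : ℕ) : (n : ℕ) → Finset (ArchFactorization n)
  | 0 => (Finset.insertNone (Finset.univ ×ˢ Finset.range K)).map ⟨rest, fun _ _ => rest.inj⟩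
  | n + 1 =>
    ((Finset.univ ×ˢ normalForms K n).sigma fun p =>
        Finset.range (if p.1 ∈ p.2.lead then K else K + 1)).map
      ⟨fun q => arch q.1.1 q.2 q.1.2, fun ⟨⟨_, _⟩, _⟩ ⟨⟨_, _⟩, _⟩ h => by cases h; rfl⟩

theorem rest_mem_normalForms {K : ℕ} {s : Option (Bool × ℕ)} :
    rest s ∈ normalForms K 0 ↔ ∀ p ∈ s, p.2 < K :=
  (Finset.mem_map' _).trans (by simp [Finset.mem_insertNone])

theorem arch_mem_normalForms {K n i : ℕ} {c : Bool} {x : ArchFactorization n} :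
    arch c i x ∈ normalForms K (n + 1) ↔
      x ∈ normalForms K n ∧ i < if c ∈ x.lead then K else K + 1 :=
  (Finset.mem_map' (a := (⟨(c, x), i⟩ : (_ : Bool × ArchFactorization n) × ℕ)) _).trans (by simp)

theorem length_lead_le {K n : ℕ} {x : ArchFactorization n} (hx : x ∈ normalForms K n) :
    x.lead.length ≤ K := by
  rcases x with (_ | ⟨c, j⟩) | ⟨c, i, x⟩
  · simp [lead]
  · simpa [lead, Nat.succ_le_iff] using rest_mem_normalForms.1 hx
  · have hi := (arch_mem_normalForms.1 hx).2
    rw [lead, length_replicate]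
    split_ifs at hi ⊢ <;> omega

theorem lead_eq_of_simonCongruence {m n K k : ℕ} {u v : List Bool} {x y : ArchFactorization n}
    (hu : LeftTight m u) (hv : LeftTight m v) (hx : x.lead.length ≤ K) (hy : y.lead.length ≤ K)
    (hk : m + n + K ≤ k) (h : simonCongruence Bool k (u ++ x.word) (v ++ y.word)) :
    x.lead = y.lead := by
  rw [← x.lead_append_tail, ← y.lead_append_tail] at h
  exact eq_of_simonCongruence
    (simonCongruence_of_sandwich hu hv x.rightTight_tail y.rightTight_tail hk h) hx hy

theorem letter_eq_of_simonCongruence {m n k : ℕ} {u v : List Bool} {c d : Bool}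
    {x y : ArchFactorization n} (hu : LeftTight m u) (hv : IsUniversal m v) (hc : c ∉ x.lead)
    (hk : m + n + 2 ≤ k)
    (h : simonCongruence Bool k (u ++ c :: (!c) :: x.word) (v ++ d :: (!d) :: y.word)) :
    c = d := by
  rw [← x.lead_append_tail, ← y.lead_append_tail] at h
  have hsub : [d, !d] <+ c :: (!c) :: x.lead :=
    sublist_of_sandwich (z' := d :: (!d) :: y.lead) hu hv x.rightTight_tail y.rightTight_tail.1 hk
      h le_rfl (by simp)
  by_contra hcd
  obtain rfl : d = !c := Bool.eq_not_of_ne (Ne.symm hcd)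
  simp_all [cons_sublist_cons']

theorem lead_rest_injective : Function.Injective fun s => (rest s).lead := by
  rintro (_ | ⟨c, i⟩) (_ | ⟨d, j⟩) h <;> simp_all [lead, replicate_inj]

theorem arch_eq_arch_of_simonCongruence {m n k i j : ℕ} {u v : List Bool} {c d : Bool}
    {x : ArchFactorization n} (hu : LeftTight m u) (hv : IsUniversal m v) (hk : m + n + 2 ≤ k)
    (hlead : (arch c i x).lead = (arch d j x).lead)
    (h : simonCongruence Bool k (u ++ (arch c i x).word) (v ++ (arch d j x).word)) :
    arch c i x = arch d j x := by
  obtain ⟨hij, hcd⟩ := replicate_inj.1 hlead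
  obtain rfl : c = d := by
    refine hcd.elim (fun h₀ => ?_) id
    obtain ⟨hc, rfl⟩ : c ∉ x.lead ∧ i = 0 := by grind
    obtain ⟨-, rfl⟩ : d ∉ x.lead ∧ j = 0 := by grind
    exact letter_eq_of_simonCongruence hu hv hc hk h
  obtain rfl : i = j := by split_ifs at hij <;> omega
  rfl

theorem eq_of_simonCongruence_append {m n K k : ℕ} {u v : List Bool} {x y : ArchFactorization n}
    (hK : 0 < K) (hu : LeftTight m u) (hv : LeftTight m v) (hx : x ∈ normalForms K n)
    (hy : y ∈ normalForms K n) (hk : m + n + K ≤ k)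
    (h : simonCongruence Bool k (u ++ x.word) (v ++ y.word)) : x = y := by
  have hlead := lead_eq_of_simonCongruence hu hv (length_lead_le hx) (length_lead_le hy) hk h
  induction x generalizing m u v with
  | rest s =>
    cases y with
    | rest t => exact congrArg rest (lead_rest_injective hlead)
  | arch c i x ih =>
    cases y with
    | arch d j y =>
      have hx' := (arch_mem_normalForms.1 hx).1
      have hy' := (arch_mem_normalForms.1 hy).1
      have hu' := hu.append_arch c i
      have hv' := hv.append_arch d j
      have h' : simonCongruence Bool k ((u ++ (replicate (i + 1) c ++ [!c])) ++ x.word)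
          ((v ++ (replicate (j + 1) d ++ [!d])) ++ y.word) := by simpa [word] using h
      obtain rfl : x = y := ih hu' hv' hx' hy' (by omega) h' (lead_eq_of_simonCongruence hu' hv'
        (length_lead_le hx') (length_lead_le hy') (by omega) h')
      exact arch_eq_arch_of_simonCongruence hu hv.1 (by omega) hlead h

theorem exists_arch_mem_normalForms {m n K k : ℕ} {u : List Bool} {x : ArchFactorization n}
    (hu : IsUniversal m u) (hx : x ∈ normalForms K n) (hk : k ≤ m + (n + 1) + K) (c : Bool)
    (i : ℕ) :
    ∃ y ∈ normalForms K (n + 1), simonCongruence Bool k (u ++ (arch c i x).word) (u ++ y.word) := by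
  obtain ⟨j, hj, hlead⟩ : ∃ j, arch c j x ∈ normalForms K (n + 1) ∧
      (arch c j x).lead = replicate (min (if c ∈ x.lead then i + 1 else i) K) c := by
    simp only [arch_mem_normalForms, hx, true_and, lead]
    split_ifs with hc
    · have hK : 0 < K := (length_pos_of_mem hc).trans_le (length_lead_le hx)
      exact ⟨min i (K - 1), by omega, by congr 1; omega⟩
    · exact ⟨min i K, by omega, rfl⟩
  refine ⟨_, hj, ?_⟩
  rw [← lead_append_tail, ← lead_append_tail, hlead]
  exact simonCongruence_replicate_min hu (rightTight_tail _).1 (by omega) c _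

theorem exists_mem_normalForms {m n K k : ℕ} {u : List Bool} (hK : 0 < K) (hu : IsUniversal m u)
    (x : ArchFactorization n) (hk : k ≤ m + n + K) :
    ∃ y ∈ normalForms K n, simonCongruence Bool k (u ++ x.word) (u ++ y.word) := by
  induction x generalizing m u with
  | rest s =>
    rcases s with _ | ⟨c, j⟩
    · exact ⟨rest none, by simp [rest_mem_normalForms], Setoid.refl' _ _⟩
    · refine ⟨rest (some (c, min j (K - 1))), by simp [rest_mem_normalForms]; omega, ?_⟩
      have := simonCongruence_replicate_min hu (isUniversal_zero []) (by omega : k ≤ m + K + 0) c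
        (j + 1)
      rwa [show min (j + 1) K = min j (K - 1) + 1 by omega, append_nil, append_nil] at this
  | arch c i x ih =>
    have hu' : IsUniversal (m + 1) (u ++ (replicate (i + 1) c ++ [!c])) :=
      hu.append_of_forall_mem (mem_replicate_succ_append_not c i)
    obtain ⟨y, hy, hxy⟩ := ih hu' (by omega)
    obtain ⟨z, hz, hyz⟩ := exists_arch_mem_normalForms hu hy (by omega) c i
    exact ⟨z, hz, Setoid.trans' _ (by simpa [word] using hxy) hyz⟩

theorem sum_normalForms_zero {M : Type*} [AddCommMonoid M] (K : ℕ) (f : ArchFactorization 0 → M) :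
    ∑ x ∈ normalForms K 0, f x =
      f (rest none) + ∑ c, ∑ j ∈ Finset.range K, f (rest (some (c, j))) := by
  rw [normalForms, Finset.sum_map, Finset.sum_insertNone, Finset.sum_product]
  rfl

theorem sum_normalForms_succ {M : Type*} [AddCommMonoid M] (K n : ℕ)
    (f : ArchFactorization (n + 1) → M) :
    ∑ x ∈ normalForms K (n + 1), f x = ∑ x ∈ normalForms K n, ∑ c,
      ∑ i ∈ Finset.range (if c ∈ x.lead then K else K + 1), f (arch c i x) := by
  rw [normalForms, Finset.sum_map, Finset.sum_sigma, Finset.sum_product_right]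
  rfl

theorem card_normalForms_succ_add (K n : ℕ) :
    (normalForms K (n + 1)).card + {x ∈ normalForms K n | x.lead ≠ []}.card =
      2 * (K + 1) * (normalForms K n).card := by
  have hx (x : ArchFactorization n) :
      ∑ c, (if c ∈ x.lead then K else K + 1) + (if x.lead ≠ [] then 1 else 0) = 2 * (K + 1) := by
    obtain ⟨j, c, h⟩ := x.exists_lead_eq_replicate
    rcases j with _ | j <;> cases c <;> simp [h] <;> ring
  rw [Finset.card_eq_sum_ones, sum_normalForms_succ, Finset.card_filter, ← Finset.sum_add_distrib,
    mul_comm, ← smul_eq_mul, ← Finset.sum_const]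
  exact Finset.sum_congr rfl fun x _ => by simpa using hx x

theorem card_filter_lead_ne_nil_succ (K n : ℕ) :
    {x ∈ normalForms K (n + 1) | x.lead ≠ []}.card = 2 * K * (normalForms K n).card := by
  have hc (c : Bool) (x : ArchFactorization n) :
      ∑ i ∈ Finset.range (if c ∈ x.lead then K else K + 1),
        (if (arch c i x).lead ≠ [] then 1 else 0) = K := by
    by_cases h : c ∈ x.lead <;> simp [lead, h, Finset.sum_range_succ']
  simp only [Finset.card_filter, sum_normalForms_succ, hc, Finset.sum_const, Finset.card_univ,
    Fintype.card_bool, smul_eq_mul]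
  ring

theorem card_normalForms_zero (K : ℕ) : (normalForms K 0).card = 2 * K + 1 := by
  simp [normalForms]

theorem card_filter_lead_ne_nil_zero (K : ℕ) :
    {x ∈ normalForms K 0 | x.lead ≠ []}.card = 2 * K := by
  simp [Finset.card_filter, sum_normalForms_zero, lead, -ne_eq]

theorem card_normalForms_and_card_filter (K n : ℕ) :
    ((normalForms K n).card : ℤ) = simonCoeff (n + K) n ∧
      ({x ∈ normalForms K n | x.lead ≠ []}.card : ℤ) =
        2 * K * simonCoeff (n - 1 + K) (n - 1) := by
  induction n with
  | zero =>
    simp [card_normalForms_zero, card_filter_lead_ne_nil_zero, simonCoeff_zero, simonCoeff_neg_one,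
      -ne_eq]
  | succ n ih =>
    obtain ⟨ih_card, ih_lead⟩ := ih
    have h_card := card_normalForms_succ_add K n
    have h_lead := card_filter_lead_ne_nil_succ K n
    zify at h_card h_lead
    rw [ih_card] at h_card h_lead
    rw [ih_lead] at h_card
    push_cast
    rw [simonCoeff_add_succ, add_sub_cancel_right]
    exact ⟨eq_sub_of_add_eq h_card, h_lead⟩

/-- A word in each congruence class: a given `k`-universal word `u`, and the normal forms with
`n < k` arches and powers of length at most `k - n`. -/
def representative (k : ℕ) (u : List Bool) :
    Option (Σ n : Fin k, normalForms (k - n) n) → List Bool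
  | none => u
  | some ⟨_, x⟩ => x.1.word

theorem representative_injective {k : ℕ} {u : List Bool} (hu : IsUniversal k u)
    {x y : Option (Σ n : Fin k, normalForms (k - n) n)}
    (h : simonCongruence Bool k (representative k u x) (representative k u y)) : x = y := by
  rcases x with _ | ⟨⟨n, hn⟩, x, hx⟩ <;> rcases y with _ | ⟨⟨m, hm⟩, y, hy⟩
  · rfl
  · exact (y.not_isUniversal_word hm (hu.of_simonCongruence le_rfl h)).elim
  · exact (x.not_isUniversal_word hn (hu.of_simonCongruence le_rfl (Setoid.symm' _ h))).elim
  · obtain rfl := arches_eq_of_simonCongruence hn hm h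
    obtain rfl := eq_of_simonCongruence_append (Nat.sub_pos_of_lt hn) leftTight_nil leftTight_nil
      hx hy (by simp; omega) h
    rfl

theorem exists_representative {k : ℕ} {u : List Bool} (hu : IsUniversal k u) (w : List Bool) :
    ∃ x, simonCongruence Bool k (representative k u x) w := by
  obtain ⟨n, x, rfl⟩ := exists_word_eq w
  rcases lt_or_ge n k with hn | hn
  · obtain ⟨y, hy, hxy⟩ := exists_mem_normalForms (Nat.sub_pos_of_lt hn) (isUniversal_zero []) x
      (by omega : k ≤ 0 + n + (k - n))
    exact ⟨some ⟨⟨n, hn⟩, y, hy⟩, Setoid.symm' _ hxy⟩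
  · exact ⟨none, hu.simonCongruence (x.isUniversal_word.mono hn)⟩

theorem bijective_quotientMk_representative {k : ℕ} {u : List Bool} (hu : IsUniversal k u) :
    Function.Bijective fun x => Quotient.mk (simonCongruence Bool k) (representative k u x) :=
  ⟨fun _ _ h => representative_injective hu (Quotient.exact h),
    Quotient.ind fun w => (exists_representative hu w).imp fun _ => Quotient.sound⟩

end ArchFactorization

end Simon

theorem mainTheorem5 (A : Type*) (hA : Nat.card A = 2) (k : ℕ) :
    Finite (Quotient (simonCongruence A k)) ∧
      (Nat.card (Quotient (simonCongruence A k)) : ℤ) =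
        1 + ∑ m ∈ Finset.range k, simonCoeff k m := by
  have : Finite A := Nat.finite_of_card_ne_zero (by omega)
  obtain ⟨e⟩ : Nonempty (A ≃ Bool) := Finite.card_eq.1 (by simp [hA])
  obtain ⟨u, hu⟩ := Simon.exists_isUniversal (A := Bool) k
  let classes := (Equiv.ofBijective _
    (Simon.ArchFactorization.bijective_quotientMk_representative hu)).trans
      (Simon.quotientCongr e k).symm
  refine ⟨.of_equiv _ classes, ?_⟩
  rw [← Nat.card_congr classes, Nat.card_eq_fintype_card, Fintype.card_option, Fintype.card_sigma]
  push_cast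
  rw [add_comm, Finset.sum_range]
  congr! with m
  rw [Fintype.card_coe, (Simon.ArchFactorization.card_normalForms_and_card_filter _ _).1,
    Nat.cast_sub m.2.le, add_sub_cancel]
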